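/- Let $f_0,\dots,f_N$ be meromorphic functions on $\mathbb C$ and let $V=\{\sum_{i=0}^N\alpha_i f_i:\alpha_i\in\mathbb C\}$ be their linear span. A meromorphic function $u$ on $\mathbb C$ is called finite-gap if, with $D=d/dz$, the Schrödinger operator $L=-D^2+u(z)$ commutes with some differential operator $A=D^{2n+1}+a_1(z)D^{2n-1}+\dots+a_{2n}(z)$ of odd order $2n+1$, $n\ge 0$, with meromorphic coefficients on $\mathbb C$. Suppose that $V$ is a finite-gap subspace, that is, $V$ contains an infinite subset $K$ which consists of finite-gap potentials and is Zariski dense in $V$ (every polynomial on the finite-dimensional vector space $V$ that vanishes on $K$ vanishes identically). Let $\Sigma=\Sigma(V)\subset\mathbb C$ be the union of the sets of poles of $f_0,\dots,f_N$. Then for every $z_0\in\Sigma$ the reflection $s(z)=2z_0-z$ satisfies $s(\Sigma)=\Sigma$, and every $u\in V$ is invariant under it: $u(2z_0-z)=u(z)$ as meromorphic functions on $\mathbb C$. -/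

import Mathlib

open Filter Topology

namespace FiniteGap

noncomputable section

/-! ### The algebra of meromorphic functions on the complex plane -/

/-- Everywhere-defined functions `ℂ → ℂ` that are meromorphic at each point of `ℂ`
(their values on a closed discrete set carry no information). -/
def MerFun : Subalgebra ℂ (ℂ → ℂ) where
  carrier := {f | Meromorphic f}
  mul_mem' hf hg := hf.mul hg
  add_mem' hf hg := hf.add hg
  algebraMap_mem' c := Meromorphic.const c

/-- The ideal of functions that vanish outside a closed discrete subset of `ℂ`. -/
def nullIdeal : Ideal MerFun where
  carrier := {f | (f : ℂ → ℂ) =ᶠ[codiscrete ℂ] 0}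
  zero_mem' := by
    change ((0 : MerFun) : ℂ → ℂ) =ᶠ[codiscrete ℂ] 0
    exact EventuallyEq.rfl
  add_mem' {f g} hf hg := by
    change (f : ℂ → ℂ) =ᶠ[codiscrete ℂ] 0 at hf
    change (g : ℂ → ℂ) =ᶠ[codiscrete ℂ] 0 at hg
    change ((f + g : MerFun) : ℂ → ℂ) =ᶠ[codiscrete ℂ] 0
    filter_upwards [hf, hg] with z h1 h2
    simp [h1, h2]
  smul_mem' c f hf := by
    change (f : ℂ → ℂ) =ᶠ[codiscrete ℂ] 0 at hf
    change ((c * f : MerFun) : ℂ → ℂ) =ᶠ[codiscrete ℂ] 0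
    filter_upwards [hf] with z h
    simp [h]

/-- Meromorphic functions on `ℂ`: two representatives are identified when they agree
outside a closed discrete set. -/
def Mer : Type := MerFun ⧸ nullIdeal

instance Mer.instCommRing : CommRing Mer := inferInstanceAs (CommRing (MerFun ⧸ nullIdeal))

instance Mer.instAlgebra : Algebra ℂ Mer := inferInstanceAs (Algebra ℂ (MerFun ⧸ nullIdeal))

/-- The meromorphic function represented by `f`. -/
def Mer.mk (f : MerFun) : Mer := Ideal.Quotient.mk nullIdeal f

theorem Mer.mk_eq_iff {f g : MerFun} :
    Mer.mk f = Mer.mk g ↔ (f : ℂ → ℂ) =ᶠ[codiscrete ℂ] (g : ℂ → ℂ) := by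
  refine (Ideal.Quotient.eq (I := nullIdeal)).trans ?_
  change ((f - g : MerFun) : ℂ → ℂ) =ᶠ[codiscrete ℂ] 0 ↔ _
  constructor
  · intro h
    filter_upwards [h] with z hz
    simpa [sub_eq_zero] using hz
  · intro h
    filter_upwards [h] with z hz
    simp [hz]

theorem eventuallyEq_codiscrete_iff {f g : ℂ → ℂ} :
    f =ᶠ[codiscrete ℂ] g ↔ ∀ z, f =ᶠ[𝓝[≠] z] g := by
  unfold Filter.EventuallyEq Filter.Eventually
  rw [codiscrete, mem_codiscreteWithin_iff_forall_mem_nhdsNE]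
  simp

theorem eventually_nhds_eq {f g : ℂ → ℂ} (h : f =ᶠ[codiscrete ℂ] g) :
    ∀ᶠ z in codiscrete ℂ, f =ᶠ[𝓝 z] g := by
  rw [eventuallyEq_codiscrete_iff] at h
  unfold Filter.Eventually
  rw [codiscrete, mem_codiscreteWithin_iff_forall_mem_nhdsNE]
  intro z _
  have h2 := (eventually_eventually_nhdsWithin (a := z) (s := {z}ᶜ)).2 (h z)
  filter_upwards [h2, self_mem_nhdsWithin] with y hy hyz
  left
  rw [IsOpen.nhdsWithin_eq isOpen_compl_singleton hyz] at hy
  exact hy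

theorem eventually_analyticAt (f : MerFun) :
    ∀ᶠ z in codiscrete ℂ, AnalyticAt ℂ (f : ℂ → ℂ) z :=
  (meromorphicOn_univ.2 f.2).analyticAt_mem_codiscreteWithin

/-- The pointwise derivative of a representative. -/
def derivFun (f : MerFun) : MerFun := ⟨_root_.deriv (f : ℂ → ℂ), f.2.deriv⟩

/-- The derivative of a representative, as a linear map into meromorphic functions. -/
def derivAux : MerFun →ₗ[ℂ] Mer where
  toFun f := Mer.mk (derivFun f)
  map_add' f g := by
    change _ = Mer.mk (derivFun f + derivFun g)
    rw [Mer.mk_eq_iff]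
    filter_upwards [eventually_analyticAt f, eventually_analyticAt g] with z hf hg
    exact deriv_add hf.differentiableAt hg.differentiableAt
  map_smul' c f := by
    change _ = Mer.mk (c • derivFun f)
    rw [Mer.mk_eq_iff]
    filter_upwards [eventually_analyticAt f] with z hf
    exact deriv_const_smul c hf.differentiableAt

theorem derivAux_eq_zero {f : MerFun} (hf : f ∈ nullIdeal.restrictScalars ℂ) :
    derivAux f = 0 := by
  change Mer.mk (derivFun f) = Mer.mk 0
  rw [Mer.mk_eq_iff]
  filter_upwards [eventually_nhds_eq (show (f : ℂ → ℂ) =ᶠ[codiscrete ℂ] 0 from hf)] with z hz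
  change _root_.deriv (f : ℂ → ℂ) z = 0
  rw [hz.deriv_eq]
  simp

/-- The differentiation operator `D = d/dz` on meromorphic functions. -/
def D : Module.End ℂ Mer :=
  (Submodule.liftQ (nullIdeal.restrictScalars ℂ) derivAux
    (fun _ hf => derivAux_eq_zero hf)).comp
    (Submodule.Quotient.restrictScalarsEquiv ℂ nullIdeal).symm.toLinearMap

theorem D_mk (f : MerFun) : D (Mer.mk f) = Mer.mk (derivFun f) := rfl

/-- `u` has a pole at `z`. -/
def HasPoleAt (u : Mer) (z : ℂ) : Prop :=
  ∃ f : MerFun, Mer.mk f = u ∧ meromorphicOrderAt (f : ℂ → ℂ) z < 0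

/-- Having a pole does not depend on the representative. -/
theorem hasPoleAt_mk (f : MerFun) (z : ℂ) :
    HasPoleAt (Mer.mk f) z ↔ meromorphicOrderAt (f : ℂ → ℂ) z < 0 := by
  refine ⟨?_, fun h => ⟨f, rfl, h⟩⟩
  rintro ⟨g, hg, h⟩
  rw [Mer.mk_eq_iff, eventuallyEq_codiscrete_iff] at hg
  rwa [← meromorphicOrderAt_congr (hg z)]

/-- The map `f ↦ f (2 z₀ - ·)` on representatives. -/
def reflectFun (z₀ : ℂ) : MerFun →ₐ[ℂ] MerFun where
  toFun f := ⟨fun z => (f : ℂ → ℂ) (2 * z₀ - z), fun z =>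
    (f.2 (2 * z₀ - z)).comp_analyticAt (g := fun z => 2 * z₀ - z) (by fun_prop)⟩
  map_one' := rfl
  map_mul' _ _ := rfl
  map_zero' := rfl
  map_add' _ _ := rfl
  commutes' _ := rfl

theorem reflectFun_mem (z₀ : ℂ) : nullIdeal ≤ nullIdeal.comap (reflectFun z₀) := by
  intro f hf
  have hf' : (f : ℂ → ℂ) =ᶠ[codiscrete ℂ] 0 := hf
  change (fun z => (f : ℂ → ℂ) (2 * z₀ - z)) =ᶠ[codiscrete ℂ] 0
  rw [eventuallyEq_codiscrete_iff] at hf' ⊢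
  intro z
  have ht : Tendsto (fun z => 2 * z₀ - z) (𝓝[≠] z) (𝓝[≠] (2 * z₀ - z)) := by
    apply tendsto_nhdsWithin_of_tendsto_nhds_of_eventually_within
    · exact ((continuous_const.sub continuous_id).tendsto z).mono_left nhdsWithin_le_nhds
    · filter_upwards [self_mem_nhdsWithin] with y hy
      simpa using hy
  exact ht.eventually (hf' (2 * z₀ - z))

/-- The map `u ↦ u (2 z₀ - ·)` on meromorphic functions. -/
def reflect (z₀ : ℂ) : Mer →ₐ[ℂ] Mer :=
  Ideal.quotientMapₐ nullIdeal (reflectFun z₀) (reflectFun_mem z₀)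

theorem reflect_mk (z₀ : ℂ) (f : MerFun) :
    reflect z₀ (Mer.mk f) = Mer.mk (reflectFun z₀ f) := rfl

/-! ### Finite-gap potentials -/

/-- Multiplication by the meromorphic function `u`, as an operator. -/
def mulOp (u : Mer) : Module.End ℂ Mer := LinearMap.mulLeft ℂ u

/-- The Schrödinger operator `L = -D² + u`. -/
def schrodinger (u : Mer) : Module.End ℂ Mer := -D ^ 2 + mulOp u

/-- The operator `D ^ (2n+1) + ∑_{j ≤ 2n-1} a_j D ^ j` of odd order `2n+1`. -/
def oddOperator (n : ℕ) (a : Fin (2 * n) → Mer) : Module.End ℂ Mer :=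
  D ^ (2 * n + 1) + ∑ j : Fin (2 * n), mulOp (a j) * D ^ (j : ℕ)

/-- `u` is finite-gap: `-D² + u` commutes with some
`D ^ (2n+1) + a_{2n-1} D ^ (2n-1) + ⋯ + a_0` with meromorphic coefficients. -/
def IsFiniteGap (u : Mer) : Prop :=
  ∃ (n : ℕ) (a : Fin (2 * n) → Mer), Commute (schrodinger u) (oddOperator n a)

/-! ### Finite-gap subspaces -/

/-- Zariski density of a subset `K` of a vector space `W` (used for finite-dimensional `W`):
a polynomial in linear coordinates on `W` that vanishes on `K` vanishes identically on `W`. -/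
def IsZariskiDense {W : Type} [AddCommGroup W] [Module ℂ W] (K : Set W) : Prop :=
  ∀ p : MvPolynomial (Module.Dual ℂ W) ℂ,
    (∀ w ∈ K, MvPolynomial.eval (fun ℓ => ℓ w) p = 0) →
      ∀ w : W, MvPolynomial.eval (fun ℓ => ℓ w) p = 0

/-- A finite-dimensional space of meromorphic functions is finite-gap if it contains an
infinite, Zariski dense subset consisting of finite-gap potentials. -/
def IsFiniteGapSubspace (V : Submodule ℂ Mer) : Prop :=
  FiniteDimensional ℂ V ∧
    ∃ K : Set V, K.Infinite ∧ (∀ u ∈ K, IsFiniteGap (u : Mer)) ∧ IsZariskiDense K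

/-- The union of the sets of poles of the functions `f i`. -/
def singularSet {ι : Type} (f : ι → Mer) : Set ℂ := {z | ∃ i, HasPoleAt (f i) z}

end

end FiniteGap

/-!
# Finite-gap subspaces of meromorphic functions

A finite-gap potential `u` has trivial monodromy at every point `z`: its Laurent series in
`T = w - z` is `m (m + 1) / T ^ 2 + ∑ c_k T ^ k` for some integer `m ≥ 0`, with
`c_{-1} = c_1 = ⋯ = c_{2 m - 1} = 0` (`IsFiniteGap.laurent_coeff`). On a finite-gap subspace `V`
the coefficient `ℓ` of `T ^ (-2)` is a linear functional. At a pole it is not zero, so by Zariski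
density it takes infinitely many values `m (m + 1)` on `K`. Each odd coefficient vanishes on the
part of `K` where `m` is large, hence the product of this coefficient with finitely many factors
`ℓ - m (m + 1)` vanishes on `K`, then on `V`, and so the coefficient vanishes on `V`
(`IsZariskiDense.functional_eq_zero`). Thus every function in `V` is even about `z`
(`IsFiniteGapSubspace.reflect_eq`).

For the local statement, write the operator that commutes with `M = D ^ 2 - u` as
`∑ (P_j + Q_j D) M ^ j`. As the operators `M ^ j` and `D M ^ j` are independent over the meromorphic
functions, the commutator vanishes only if `R_i = (-1) ^ i Q_{n - i}` solves
`R_{i + 1}' = u R_i' + u' R_i / 2 - R_i''' / 4` with `R_0 = 1` and `R_{n + 1} = 0`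
(`IsFiniteGap.exists_recursion`). Leading Laurent coefficients do the rest:

* if `u` had a pole of order `p > 2`, then `R_i` would have a pole of order `p i` for all `i`;
* if `u = c / T ^ 2 + ⋯`, the coefficient of `T ^ (-2 i)` in `R_i` gets multiplied at each step
  by a nonzero multiple of `c - i (i + 1)`, so `c = m (m + 1)` for some `m ≤ n`;
* if `2 r - 1 ≤ 2 m - 1` is the least odd exponent in `u`, comparison of the recursion with its
  reflection gives a recursion for the coefficients of `T ^ (2 r + 1 - 2 i)` in the odd parts of
  the `R_i`. A sign argument shows that they are nonzero for all `i > r`, in contradiction to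
  `R_{n + 1} = 0` (`coeff_odd_eq_zero`).
-/

open Filter Topology

namespace FiniteGap

noncomputable section

open scoped LaurentSeries

/-! ### Laurent expansions of meromorphic functions -/

/-- The Taylor series of `g` at `z`, written in the local parameter `w - z`. -/
def taylorAt (g : ℂ → ℂ) (z : ℂ) : PowerSeries ℂ :=
  PowerSeries.mk fun n => iteratedDeriv n g z / (n.factorial : ℂ)

theorem coeff_taylorAt (g : ℂ → ℂ) (z : ℂ) (n : ℕ) :
    PowerSeries.coeff n (taylorAt g z) = iteratedDeriv n g z / (n.factorial : ℂ) :=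
  PowerSeries.coeff_mk _ _

theorem taylorAt_congr {g h : ℂ → ℂ} {z : ℂ} (hgh : g =ᶠ[𝓝 z] h) :
    taylorAt g z = taylorAt h z := by
  ext n
  rw [coeff_taylorAt, coeff_taylorAt, hgh.iteratedDeriv_eq]

theorem taylorAt_add {g h : ℂ → ℂ} {z : ℂ} (hg : AnalyticAt ℂ g z) (hh : AnalyticAt ℂ h z) :
    taylorAt (g + h) z = taylorAt g z + taylorAt h z := by
  ext n
  rw [map_add, coeff_taylorAt, coeff_taylorAt, coeff_taylorAt,
    iteratedDeriv_add hg.contDiffAt hh.contDiffAt, add_div]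

theorem taylorAt_mul {g h : ℂ → ℂ} {z : ℂ} (hg : AnalyticAt ℂ g z) (hh : AnalyticAt ℂ h z) :
    taylorAt (g * h) z = taylorAt g z * taylorAt h z := by
  ext n
  rw [PowerSeries.coeff_mul, coeff_taylorAt, iteratedDeriv_mul hg.contDiffAt hh.contDiffAt,
    Finset.Nat.sum_antidiagonal_eq_sum_range_succ
      (fun i j => PowerSeries.coeff i (taylorAt g z) * PowerSeries.coeff j (taylorAt h z)),
    Finset.sum_div]
  refine Finset.sum_congr rfl fun i hi => ?_
  have hin : i ≤ n := Nat.lt_succ_iff.1 (Finset.mem_range.1 hi)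
  rw [coeff_taylorAt, coeff_taylorAt, Nat.cast_choose ℂ hin]
  have h1 : (n.factorial : ℂ) ≠ 0 := Nat.cast_ne_zero.2 n.factorial_ne_zero
  field_simp

theorem taylorAt_const (c z : ℂ) : taylorAt (fun _ => c) z = PowerSeries.C c := by
  ext n
  rw [coeff_taylorAt, PowerSeries.coeff_C, iteratedDeriv_const]
  split_ifs with h <;> simp [h]

theorem taylorAt_sub (z : ℂ) : taylorAt (fun w => w - z) z = PowerSeries.X := by
  ext n
  rw [coeff_taylorAt, PowerSeries.coeff_X]
  rcases n with _ | _ | n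
  · simp
  · simp [iteratedDeriv_one]
  · have h1 : _root_.deriv (fun w : ℂ => w - z) = fun _ => 1 := by
      funext w
      simp
    rw [iteratedDeriv_succ', h1, iteratedDeriv_const]
    simp

theorem taylorAt_pow (z : ℂ) (n : ℕ) :
    taylorAt (fun w => (w - z) ^ n) z = PowerSeries.X ^ n := by
  induction n with
  | zero => simpa using taylorAt_const 1 z
  | succ n ih =>
    have h : (fun w : ℂ => (w - z) ^ (n + 1)) = (fun w => (w - z) ^ n) * fun w => w - z := by
      funext w
      simp [pow_succ]
    rw [h, taylorAt_mul (by fun_prop) (by fun_prop), ih, taylorAt_sub, pow_succ]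

theorem coeff_taylorAt_deriv (g : ℂ → ℂ) (z : ℂ) (n : ℕ) :
    PowerSeries.coeff n (taylorAt (_root_.deriv g) z) =
      (n + 1) * PowerSeries.coeff (n + 1) (taylorAt g z) := by
  rw [coeff_taylorAt, coeff_taylorAt, iteratedDeriv_succ', Nat.factorial_succ, Nat.cast_mul]
  have h1 : (n.factorial : ℂ) ≠ 0 := Nat.cast_ne_zero.2 n.factorial_ne_zero
  have h2 : ((n + 1 : ℕ) : ℂ) ≠ 0 := Nat.cast_ne_zero.2 n.succ_ne_zero
  push_cast at *
  field_simp

theorem eventually_eq_zero_of_taylorAt {g : ℂ → ℂ} {z : ℂ} (hg : AnalyticAt ℂ g z)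
    (h : taylorAt g z = 0) : ∀ᶠ w in 𝓝 z, g w = 0 := by
  have h1 := hg.hasFPowerSeriesAt
  have h2 : (FormalMultilinearSeries.ofScalars ℂ
      fun n => iteratedDeriv n g z / (n.factorial : ℂ)) = 0 := by
    rw [FormalMultilinearSeries.ofScalars_series_eq_zero]
    funext n
    rw [← coeff_taylorAt, h]
    simp
  rw [h2] at h1
  exact h1.eventually_eq_zero

theorem exists_eq_zpow_mul (f : MerFun) (z : ℂ) :
    ∃ (n : ℕ) (g : ℂ → ℂ), AnalyticAt ℂ g z ∧
      ∀ᶠ w in 𝓝[≠] z, (f : ℂ → ℂ) w = (w - z) ^ (-(n : ℤ)) * g w := by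
  obtain ⟨n, hn⟩ := f.2 z
  refine ⟨n, _, hn, ?_⟩
  filter_upwards [self_mem_nhdsWithin] with w hw
  have h0 : w - z ≠ 0 := sub_ne_zero.2 hw
  simp [h0]

/-- The Laurent expansion at `z` of a representative: if `f = (w - z) ^ (-n) * g` near `z` with
`g` analytic, it is `T ^ (-n)` times the Taylor series of `g`. It does not depend on the choice
of `n` and `g`, see `laurentFun_eq`. -/
def laurentFun (z : ℂ) (f : MerFun) : ℂ⸨X⸩ :=
  HahnSeries.single (-((exists_eq_zpow_mul f z).choose : ℤ)) 1 *
    HahnSeries.ofPowerSeries ℤ ℂ (taylorAt (exists_eq_zpow_mul f z).choose_spec.choose z)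

theorem single_mul_taylorAt_eq {g h : ℂ → ℂ} {z : ℂ} {m n : ℤ} (hg : AnalyticAt ℂ g z)
    (hh : AnalyticAt ℂ h z)
    (e : ∀ᶠ w in 𝓝[≠] z, (w - z) ^ m * g w = (w - z) ^ n * h w) :
    (HahnSeries.single m 1 * HahnSeries.ofPowerSeries ℤ ℂ (taylorAt g z) : ℂ⸨X⸩) =
      HahnSeries.single n 1 * HahnSeries.ofPowerSeries ℤ ℂ (taylorAt h z) := by
  wlog hmn : m ≤ n generalizing g h m n
  · exact (this hh hg (e.mono fun _ h => h.symm) (le_of_not_ge hmn)).symm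
  obtain ⟨k, rfl⟩ := Int.le.dest hmn
  have hk : AnalyticAt ℂ (fun w => (w - z) ^ k) z := by fun_prop
  have h1 : g =ᶠ[𝓝 z] (fun w => (w - z) ^ k) * h := by
    refine (AnalyticAt.frequently_eq_iff_eventually_eq hg (hk.mul hh)).1 (Eventually.frequently ?_)
    filter_upwards [e, self_mem_nhdsWithin] with w hw hwz
    have h0 : w - z ≠ 0 := sub_ne_zero.2 hwz
    rw [zpow_add₀ h0, mul_assoc, zpow_natCast] at hw
    exact mul_left_cancel₀ (zpow_ne_zero _ h0) hw
  rw [taylorAt_congr h1, taylorAt_mul hk hh, taylorAt_pow, map_mul,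
    HahnSeries.ofPowerSeries_X_pow, ← mul_assoc, HahnSeries.single_mul_single, one_mul]

theorem laurentFun_eq {f : MerFun} {z : ℂ} {n : ℤ} {g : ℂ → ℂ} (hg : AnalyticAt ℂ g z)
    (h : ∀ᶠ w in 𝓝[≠] z, (f : ℂ → ℂ) w = (w - z) ^ n * g w) :
    laurentFun z f =
      HahnSeries.single n 1 * HahnSeries.ofPowerSeries ℤ ℂ (taylorAt g z) := by
  obtain ⟨h1, h2⟩ := (exists_eq_zpow_mul f z).choose_spec.choose_spec
  refine single_mul_taylorAt_eq h1 hg ?_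
  filter_upwards [h, h2] with w hw hw'
  rw [← hw, hw']

theorem laurentFun_congr {f g : MerFun} {z : ℂ} (h : (f : ℂ → ℂ) =ᶠ[𝓝[≠] z] g) :
    laurentFun z f = laurentFun z g := by
  obtain ⟨n, k, hk, e⟩ := exists_eq_zpow_mul g z
  rw [laurentFun_eq hk e, laurentFun_eq hk]
  filter_upwards [h, e] with w h1 h2
  rw [h1, h2]

theorem laurentFun_const (z c : ℂ) :
    laurentFun z (algebraMap ℂ MerFun c) = algebraMap ℂ ℂ⸨X⸩ c := by
  rw [laurentFun_eq (n := 0) (g := fun _ => c) analyticAt_const, taylorAt_const]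
  · simp [LaurentSeries.algebraMap_apply, HahnSeries.C_apply]
  · refine Eventually.of_forall fun w => ?_
    rw [zpow_zero, one_mul]
    rfl

theorem laurentFun_mul (z : ℂ) (f g : MerFun) :
    laurentFun z (f * g) = laurentFun z f * laurentFun z g := by
  obtain ⟨m, a, ha, ea⟩ := exists_eq_zpow_mul f z
  obtain ⟨n, b, hb, eb⟩ := exists_eq_zpow_mul g z
  rw [laurentFun_eq ha ea, laurentFun_eq hb eb,
    laurentFun_eq (n := -(m : ℤ) + -(n : ℤ)) (ha.mul hb), taylorAt_mul ha hb, map_mul,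
    mul_mul_mul_comm, HahnSeries.single_mul_single, one_mul]
  filter_upwards [ea, eb, self_mem_nhdsWithin] with w h1 h2 hw
  change (f : ℂ → ℂ) w * (g : ℂ → ℂ) w = _ * (a w * b w)
  rw [h1, h2, zpow_add₀ (sub_ne_zero.2 hw)]
  ring

theorem laurentFun_add (z : ℂ) (f g : MerFun) :
    laurentFun z (f + g) = laurentFun z f + laurentFun z g := by
  obtain ⟨m, a, ha, ea⟩ := exists_eq_zpow_mul f z
  obtain ⟨n, b, hb, eb⟩ := exists_eq_zpow_mul g z
  have hm : AnalyticAt ℂ (fun w => (w - z) ^ m) z := by fun_prop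
  have hn : AnalyticAt ℂ (fun w => (w - z) ^ n) z := by fun_prop
  rw [laurentFun_eq (f := f) (n := -((m + n : ℕ) : ℤ)) (hn.mul ha)
      (by
        filter_upwards [ea, self_mem_nhdsWithin] with w h1 hw
        have h0 : w - z ≠ 0 := sub_ne_zero.2 hw
        rw [h1, zpow_neg, zpow_neg, zpow_natCast, zpow_natCast, pow_add]
        simp only [Pi.mul_apply]
        field_simp),
    laurentFun_eq (f := g) (n := -((m + n : ℕ) : ℤ)) (hm.mul hb)
      (by
        filter_upwards [eb, self_mem_nhdsWithin] with w h1 hw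
        have h0 : w - z ≠ 0 := sub_ne_zero.2 hw
        rw [h1, zpow_neg, zpow_neg, zpow_natCast, zpow_natCast, pow_add]
        simp only [Pi.mul_apply]
        field_simp),
    laurentFun_eq (n := -((m + n : ℕ) : ℤ)) ((hn.mul ha).add (hm.mul hb)),
    taylorAt_add (hn.mul ha) (hm.mul hb), map_add, mul_add]
  filter_upwards [ea, eb, self_mem_nhdsWithin] with w h1 h2 hw
  have h0 : w - z ≠ 0 := sub_ne_zero.2 hw
  change (f : ℂ → ℂ) w + (g : ℂ → ℂ) w = _ * ((w - z) ^ n * a w + (w - z) ^ m * b w)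
  rw [h1, h2, zpow_neg, zpow_neg, zpow_neg, zpow_natCast, zpow_natCast, zpow_natCast, pow_add]
  field_simp

/-- The coefficients of a Laurent series `T ^ n * P`, `P` a power series. -/
theorem coeff_single_mul_ofPowerSeries (n k : ℤ) (p : PowerSeries ℂ) :
    (HahnSeries.single n 1 * HahnSeries.ofPowerSeries ℤ ℂ p : ℂ⸨X⸩).coeff k =
      if k < n then 0 else PowerSeries.coeff (k - n).toNat p := by
  rw [HahnSeries.coeff_single_mul, one_mul, PowerSeries.coeff_coe]
  by_cases h : k < n
  · rw [if_pos h, if_pos (by omega)]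
  · rw [if_neg h, if_neg (by omega)]
    congr 2
    omega

theorem coeff_laurentFun_derivFun (z : ℂ) (f : MerFun) (k : ℤ) :
    (laurentFun z (derivFun f)).coeff k = (k + 1) * (laurentFun z f).coeff (k + 1) := by
  obtain ⟨n, g, hg, e⟩ := exists_eq_zpow_mul f z
  have hz : AnalyticAt ℂ (fun w => w - z) z := by fun_prop
  have hc : AnalyticAt ℂ (fun _ : ℂ => -(n : ℂ)) z := analyticAt_const
  have hd : ∀ᶠ w in 𝓝[≠] z, (derivFun f : ℂ → ℂ) w = (w - z) ^ (-((n + 1 : ℕ) : ℤ)) *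
      ((fun w => w - z) * _root_.deriv g + (fun _ => -(n : ℂ)) * g : ℂ → ℂ) w := by
    filter_upwards [eventually_eventually_nhdsWithin.2 e, self_mem_nhdsWithin,
      hg.eventually_analyticAt.filter_mono nhdsWithin_le_nhds] with w h1 hw h2
    rw [IsOpen.nhdsWithin_eq isOpen_compl_singleton hw] at h1
    have h0 : w - z ≠ 0 := sub_ne_zero.2 hw
    have h3 : HasDerivAt (fun w : ℂ => (w - z) ^ (-(n : ℤ)))
        ((-(n : ℤ) : ℤ) * (w - z) ^ (-(n : ℤ) - 1)) w := by
      have h := (hasDerivAt_zpow (-(n : ℤ)) (w - z) (Or.inl h0)).comp w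
        ((hasDerivAt_id w).sub_const z)
      rw [mul_one] at h
      exact h
    have h4 := h3.mul h2.differentiableAt.hasDerivAt
    change _root_.deriv (f : ℂ → ℂ) w = _
    rw [EventuallyEq.deriv_eq h1]
    refine h4.deriv.trans ?_
    simp only [Pi.mul_apply, Pi.add_apply]
    have h5 : (w - z) ^ (-((n + 1 : ℕ) : ℤ)) * (w - z) = (w - z) ^ (-(n : ℤ)) := by
      rw [← zpow_add_one₀ h0]
      congr 1
      push_cast
      ring
    have h6 : -((n + 1 : ℕ) : ℤ) = -(n : ℤ) - 1 := by
      push_cast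
      ring
    rw [mul_add, ← mul_assoc, h5, h6]
    push_cast
    ring
  rw [laurentFun_eq hg e, laurentFun_eq ((hz.mul hg.deriv).add (hc.mul hg)) hd,
    taylorAt_add (hz.mul hg.deriv) (hc.mul hg), taylorAt_mul hz hg.deriv, taylorAt_mul hc hg,
    taylorAt_sub, taylorAt_const, coeff_single_mul_ofPowerSeries, coeff_single_mul_ofPowerSeries]
  by_cases h : k < -((n + 1 : ℕ) : ℤ)
  · rw [if_pos h, if_pos (by omega), mul_zero]
  · rw [if_neg h, if_neg (by omega)]
    obtain ⟨j, rfl⟩ : ∃ j : ℕ, k = j - (n + 1 : ℕ) := ⟨(k + (n + 1 : ℕ)).toNat, by omega⟩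
    have h1 : ((j : ℤ) - (n + 1 : ℕ) - -((n + 1 : ℕ) : ℤ)).toNat = j := by omega
    have h2 : ((j : ℤ) - (n + 1 : ℕ) + 1 - -(n : ℤ)).toNat = j := by omega
    rw [h1, h2, map_add, PowerSeries.coeff_C_mul]
    rcases j with _ | j
    · simp
    · rw [PowerSeries.coeff_succ_X_mul, coeff_taylorAt_deriv]
      push_cast
      ring

theorem coeff_laurentFun_reflectFun (z : ℂ) (f : MerFun) (k : ℤ) :
    (laurentFun z (reflectFun z f)).coeff k = (-1) ^ k * (laurentFun z f).coeff k := by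
  obtain ⟨n, g, hg, e⟩ := exists_eq_zpow_mul f z
  have ht : Tendsto (fun w => 2 * z - w) (𝓝[≠] z) (𝓝[≠] z) := by
    apply tendsto_nhdsWithin_of_tendsto_nhds_of_eventually_within
    · have : Tendsto (fun w => 2 * z - w) (𝓝 z) (𝓝 (2 * z - z)) :=
        (continuous_const.sub continuous_id).tendsto z
      rw [show 2 * z - z = z by ring] at this
      exact this.mono_left nhdsWithin_le_nhds
    · filter_upwards [self_mem_nhdsWithin] with y hy
      intro h
      apply hy
      change 2 * z - y = z at h
      change y = z
      linear_combination -h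
  have hg' : AnalyticAt ℂ (fun w => g (2 * z - w)) z := by
    have h1 : AnalyticAt ℂ g (2 * z - z) := by
      rw [show 2 * z - z = z by ring]
      exact hg
    exact h1.comp (f := fun w => 2 * z - w) (by fun_prop)
  have hc : AnalyticAt ℂ (fun _ : ℂ => (-1 : ℂ) ^ n) z := analyticAt_const
  have e' : ∀ᶠ w in 𝓝[≠] z, (reflectFun z f : ℂ → ℂ) w = (w - z) ^ (-(n : ℤ)) *
      ((fun _ : ℂ => (-1 : ℂ) ^ n) * fun w => g (2 * z - w)) w := by
    filter_upwards [ht.eventually e, self_mem_nhdsWithin] with w h1 hw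
    change (f : ℂ → ℂ) (2 * z - w) = _
    rw [h1, show 2 * z - w - z = (-1) * (w - z) by ring, mul_zpow]
    simp only [Pi.mul_apply, zpow_neg, zpow_natCast, ← inv_pow]
    norm_num
    ring
  rw [laurentFun_eq hg e, laurentFun_eq (hc.mul hg') e', taylorAt_mul hc hg', taylorAt_const,
    coeff_single_mul_ofPowerSeries, coeff_single_mul_ofPowerSeries]
  by_cases h : k < -(n : ℤ)
  · rw [if_pos h, if_pos h, mul_zero]
  · rw [if_neg h, if_neg h]
    obtain ⟨j, rfl⟩ : ∃ j : ℕ, k = j - n := ⟨(k + n).toNat, by omega⟩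
    have h1 : ((j : ℤ) - n - -(n : ℤ)).toNat = j := by omega
    rw [h1, PowerSeries.coeff_C_mul, coeff_taylorAt, coeff_taylorAt,
      iteratedDeriv_comp_const_sub]
    beta_reduce
    rw [show 2 * z - z = z by ring, smul_eq_mul,
      zpow_sub₀ (by norm_num), zpow_natCast, zpow_natCast, div_eq_mul_inv _ ((-1 : ℂ) ^ n),
      ← inv_pow]
    norm_num
    ring

/-- A meromorphic function whose Laurent expansion at one point is zero vanishes identically. -/
theorem mem_nullIdeal_of_laurentFun_eq_zero {z : ℂ} {f : MerFun} (h : laurentFun z f = 0) :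
    f ∈ nullIdeal := by
  change (f : ℂ → ℂ) =ᶠ[codiscrete ℂ] 0
  rw [eventuallyEq_codiscrete_iff]
  obtain ⟨n, g, hg, e⟩ := exists_eq_zpow_mul f z
  have hz : meromorphicOrderAt (f : ℂ → ℂ) z = ⊤ := by
    rw [meromorphicOrderAt_eq_top_iff]
    rw [laurentFun_eq hg e, mul_eq_zero] at h
    have h1 : taylorAt g z = 0 := by
      rcases h with h | h
      · simp at h
      · exact HahnSeries.ofPowerSeries_injective (by rw [h, map_zero])
    filter_upwards [e, (eventually_eq_zero_of_taylorAt hg h1).filter_mono nhdsWithin_le_nhds]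
      with w h2 h3
    rw [h2, h3, mul_zero]
  have hall := MeromorphicOn.exists_meromorphicOrderAt_ne_top_iff_forall
    (meromorphicOn_univ.2 f.2) isConnected_univ
  intro w
  have hw : meromorphicOrderAt (f : ℂ → ℂ) w = ⊤ := by
    by_contra hne
    exact hall.1 ⟨⟨w, trivial⟩, hne⟩ ⟨z, trivial⟩ hz
  exact meromorphicOrderAt_eq_top_iff.1 hw

theorem exists_coeff_laurentFun_ne_zero {z : ℂ} {f : MerFun}
    (h : meromorphicOrderAt (f : ℂ → ℂ) z < 0) :
    ∃ k < 0, (laurentFun z f).coeff k ≠ 0 := by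
  obtain ⟨n, hn⟩ := WithTop.ne_top_iff_exists.1 h.ne_top
  rw [← hn] at h
  obtain ⟨g, hg, hg0, e⟩ := (meromorphicOrderAt_eq_int_iff (f.2 z)).1 hn.symm
  refine ⟨n, by exact_mod_cast h, ?_⟩
  rw [laurentFun_eq hg e, coeff_single_mul_ofPowerSeries, if_neg (lt_irrefl n), sub_self,
    Int.toNat_zero, coeff_taylorAt]
  simpa using hg0

/-- The Laurent expansion at `z`, as an algebra homomorphism on representatives. -/
def laurentHom (z : ℂ) : MerFun →ₐ[ℂ] ℂ⸨X⸩ where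
  toFun := laurentFun z
  map_one' := by simpa using laurentFun_const z 1
  map_mul' := laurentFun_mul z
  map_zero' := by simpa using laurentFun_const z 0
  map_add' := laurentFun_add z
  commutes' := laurentFun_const z

/-- The Laurent expansion of a meromorphic function at `z`. -/
def laurent (z : ℂ) : Mer →ₐ[ℂ] ℂ⸨X⸩ :=
  Ideal.Quotient.liftₐ nullIdeal (laurentHom z) fun f hf => by
    have h1 : laurentFun z f = laurentFun z 0 :=
      laurentFun_congr (eventuallyEq_codiscrete_iff.1 hf z)
    exact h1.trans (map_zero (laurentHom z))

theorem Mer.mk_surjective : Function.Surjective Mer.mk := Ideal.Quotient.mk_surjective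

theorem laurent_injective (z : ℂ) : Function.Injective (laurent z) := by
  rw [injective_iff_map_eq_zero]
  intro u hu
  obtain ⟨f, rfl⟩ := Mer.mk_surjective u
  exact Ideal.Quotient.eq_zero_iff_mem.2 (mem_nullIdeal_of_laurentFun_eq_zero hu)

theorem coeff_laurent_D (z : ℂ) (u : Mer) (k : ℤ) :
    (laurent z (D u)).coeff k = (k + 1) * (laurent z u).coeff (k + 1) := by
  obtain ⟨f, rfl⟩ := Mer.mk_surjective u
  exact coeff_laurentFun_derivFun z f k

theorem coeff_laurent_reflect (z : ℂ) (u : Mer) (k : ℤ) :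
    (laurent z (reflect z u)).coeff k = (-1) ^ k * (laurent z u).coeff k := by
  obtain ⟨f, rfl⟩ := Mer.mk_surjective u
  exact coeff_laurentFun_reflectFun z f k

theorem exists_coeff_laurent_ne_zero {z : ℂ} {u : Mer} (h : HasPoleAt u z) :
    ∃ k < 0, (laurent z u).coeff k ≠ 0 := by
  obtain ⟨f, rfl, hf⟩ := h
  exact exists_coeff_laurentFun_ne_zero hf

/-- The reflection carries the poles of `u` to those of its image. -/
theorem hasPoleAt_of_hasPoleAt_reflect {z₀ z : ℂ} {u : Mer} (h : HasPoleAt (reflect z₀ u) z) :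
    HasPoleAt u (2 * z₀ - z) := by
  obtain ⟨f, rfl⟩ := Mer.mk_surjective u
  rw [reflect_mk, hasPoleAt_mk] at h
  rw [hasPoleAt_mk]
  have h1 : MeromorphicAt (f : ℂ → ℂ) (2 * z₀ - z) := f.2 _
  by_contra hcon
  obtain ⟨g, hg, e⟩ := h1.meromorphicOrderAt_nonneg_iff.1 (not_lt.1 hcon)
  refine absurd h (not_lt.2 (((reflectFun z₀ f).2 z).meromorphicOrderAt_nonneg_iff.2
    ⟨fun w => g (2 * z₀ - w), hg.comp (f := fun w => 2 * z₀ - w) (by fun_prop), ?_⟩))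
  have ht : Tendsto (fun w => 2 * z₀ - w) (𝓝[≠] z) (𝓝[≠] (2 * z₀ - z)) := by
    apply tendsto_nhdsWithin_of_tendsto_nhds_of_eventually_within
    · exact ((continuous_const.sub continuous_id).tendsto z).mono_left nhdsWithin_le_nhds
    · filter_upwards [self_mem_nhdsWithin] with y hy
      simpa using hy
  exact ht.eventually e

theorem D_mul (u v : Mer) : D (u * v) = D u * v + u * D v := by
  obtain ⟨f, rfl⟩ := Mer.mk_surjective u
  obtain ⟨g, rfl⟩ := Mer.mk_surjective v
  change Mer.mk (derivFun (f * g)) = Mer.mk (derivFun f * g + f * derivFun g)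
  rw [Mer.mk_eq_iff]
  filter_upwards [eventually_analyticAt f, eventually_analyticAt g] with z hf hg
  exact deriv_mul hf.differentiableAt hg.differentiableAt

theorem D_algebraMap (c : ℂ) : D (algebraMap ℂ Mer c) = 0 := by
  change Mer.mk (derivFun (algebraMap ℂ MerFun c)) = Mer.mk 0
  rw [Mer.mk_eq_iff]
  refine Eventually.of_forall fun z => ?_
  exact deriv_const z c

theorem D_reflect (z₀ : ℂ) (u : Mer) : D (reflect z₀ u) = -reflect z₀ (D u) := by
  obtain ⟨f, rfl⟩ := Mer.mk_surjective u
  change Mer.mk (derivFun (reflectFun z₀ f)) = Mer.mk (-reflectFun z₀ (derivFun f))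
  rw [Mer.mk_eq_iff]
  refine Eventually.of_forall fun z => ?_
  exact deriv_comp_const_sub _ _ _

/-- The coordinate function `z` of `ℂ`. -/
def coordinate : Mer := Mer.mk ⟨fun z => z, fun z => MeromorphicAt.id z⟩

theorem D_coordinate : D coordinate = 1 := by
  change Mer.mk (derivFun _) = Mer.mk 1
  rw [Mer.mk_eq_iff]
  refine Eventually.of_forall fun z => ?_
  exact deriv_id z

/-! ### Leading coefficients of Laurent series -/

/-- The formal derivative of Laurent series. -/
def formalD : ℂ⸨X⸩ →ₗ[ℂ] ℂ⸨X⸩ := LaurentSeries.derivative ℂ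

theorem coeff_formalD (x : ℂ⸨X⸩) (k : ℤ) :
    (formalD x).coeff k = (k + 1) * x.coeff (k + 1) := by
  simp [formalD, LaurentSeries.derivative_apply]

theorem laurent_D (z : ℂ) (u : Mer) : laurent z (D u) = formalD (laurent z u) := by
  ext k
  rw [coeff_laurent_D, coeff_formalD]

/-- `x = a T ^ k + O(T ^ (k + 1))`; the coefficient `a` may be zero. -/
def IsLead (x : ℂ⸨X⸩) (k : ℤ) (a : ℂ) : Prop := (∀ j < k, x.coeff j = 0) ∧ x.coeff k = a

namespace IsLead

variable {x y : ℂ⸨X⸩} {k l : ℤ} {a b : ℂ}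

theorem add (hx : IsLead x k a) (hy : IsLead y k b) : IsLead (x + y) k (a + b) :=
  ⟨fun j hj => by simp [hx.1 j hj, hy.1 j hj], by simp [hx.2, hy.2]⟩

theorem sub (hx : IsLead x k a) (hy : IsLead y k b) : IsLead (x - y) k (a - b) :=
  ⟨fun j hj => by simp [hx.1 j hj, hy.1 j hj], by simp [hx.2, hy.2]⟩

theorem smul (c : ℂ) (hx : IsLead x k a) : IsLead (c • x) k (c * a) :=
  ⟨fun j hj => by simp [hx.1 j hj], by simp [hx.2]⟩

theorem mul (hx : IsLead x k a) (hy : IsLead y l b) : IsLead (x * y) (k + l) (a * b) := by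
  have key : ∀ i j : ℤ, x.coeff i * y.coeff j ≠ 0 → k ≤ i ∧ l ≤ j := by
    intro i j h
    refine ⟨?_, ?_⟩
    · by_contra hlt
      exact h (by rw [hx.1 i (not_le.1 hlt), zero_mul])
    · by_contra hlt
      exact h (by rw [hy.1 j (not_le.1 hlt), mul_zero])
  constructor
  · intro n hn
    rw [HahnSeries.coeff_mul]
    refine Finset.sum_eq_zero fun p hp => ?_
    by_contra h
    have h1 := key p.1 p.2 h
    have h2 := (Finset.mem_antidiagonal.1 hp).2.2
    omega
  · rw [HahnSeries.coeff_mul, Finset.sum_eq_single (k, l), hx.2, hy.2]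
    · intro p hp hne
      by_contra h
      have h1 := key p.1 p.2 h
      have h2 := (Finset.mem_antidiagonal.1 hp).2.2
      exact hne (Prod.ext (by dsimp only; omega) (by dsimp only; omega))
    · intro hp
      by_contra h
      refine hp (Finset.mem_antidiagonal.2 ⟨?_, ?_, rfl⟩)
      · exact fun h0 => h (by rw [h0, zero_mul])
      · exact fun h0 => h (by rw [h0, mul_zero])

theorem deriv (hx : IsLead x k a) : IsLead (formalD x) (k - 1) (k * a) :=
  ⟨fun j hj => by rw [coeff_formalD, hx.1 (j + 1) (by omega), mul_zero], by
    rw [coeff_formalD, sub_add_cancel, hx.2]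
    push_cast
    ring⟩

theorem mono (hx : IsLead x k a) (h : l < k) : IsLead x l 0 :=
  ⟨fun j hj => hx.1 j (hj.trans h), hx.1 l h⟩

theorem congr (hx : IsLead x k a) (hk : k = l) (ha : a = b) : IsLead x l b := hk ▸ ha ▸ hx

theorem eq_zero_of_zero (h : IsLead 0 k a) : a = 0 := h.2.symm.trans HahnSeries.coeff_zero

/-- Integration of leading terms: no logarithm or constant of integration interferes when the
constant coefficient is zero or is not below the leading exponent. -/
theorem of_deriv (h : IsLead (formalD x) (k - 1) a) (hk : k ≠ 0)
    (h0 : 0 < k → x.coeff 0 = 0) : IsLead x k (a / k) := by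
  constructor
  · intro j hj
    rcases eq_or_ne j 0 with rfl | hj0
    · exact h0 hj
    have h1 := h.1 (j - 1) (by omega)
    rw [coeff_formalD, sub_add_cancel] at h1
    refine (mul_eq_zero.1 h1).resolve_left ?_
    push_cast
    rw [sub_add_cancel]
    exact_mod_cast hj0
  · have h1 := h.2
    rw [coeff_formalD, sub_add_cancel] at h1
    have hk' : (k : ℂ) ≠ 0 := by exact_mod_cast hk
    rw [eq_div_iff hk', ← h1]
    push_cast
    ring

end IsLead

/-! ### The recursion of a finite-gap potential at a point -/

/-- The recursion `R (i + 1)' = u R i' + u' R i / 2 - R i''' / 4`, satisfied by the coefficients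
in `λ` of a solution of the equation for products of two solutions of `ψ'' = (u - λ) ψ`. -/
def IsResolvent (u : ℂ⸨X⸩) (R : ℕ → ℂ⸨X⸩) : Prop :=
  ∀ i, formalD (R (i + 1)) = u * formalD (R i) + (1 / 2 : ℂ) • (formalD u * R i) -
    (1 / 4 : ℂ) • formalD (formalD (formalD (R i)))

theorem isLead_one : IsLead 1 0 1 :=
  ⟨fun j hj => by rw [HahnSeries.coeff_one, if_neg hj.ne], by simp⟩

variable {u : ℂ⸨X⸩} {R : ℕ → ℂ⸨X⸩} {n : ℕ}

theorem coeff_eq_zero_of_lt_neg_two (hR : IsResolvent u R) (h0 : R 0 = 1) (hn : R n = 0) {k : ℤ}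
    (hk : k < -2) : u.coeff k = 0 := by
  by_contra hne
  have hu : u ≠ 0 := by
    rintro rfl
    simp at hne
  -- the pole of order `-p > 2` is multiplied at each step, as the term `R'''` is negligible
  obtain ⟨p, hp⟩ : ∃ p, p = u.order := ⟨_, rfl⟩
  have hpk : p < -2 := by
    rw [hp]
    exact (HahnSeries.order_le_of_coeff_ne_zero hne).trans_lt hk
  have ha : u.coeff p ≠ 0 := by
    rw [hp]
    exact HahnSeries.coeff_order_eq_zero.not.2 hu
  have hlead : IsLead u p (u.coeff p) :=
    ⟨fun j hj => HahnSeries.coeff_eq_zero_of_lt_order (hp ▸ hj), rfl⟩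
  have key : ∀ i : ℕ, ∃ r : ℂ, r ≠ 0 ∧ IsLead (R i) (p * i) r := by
    intro i
    induction i with
    | zero => exact ⟨1, one_ne_zero, by rw [h0]; exact isLead_one.congr (by simp) rfl⟩
    | succ i ih =>
      obtain ⟨r, hr, h⟩ := ih
      have h1 := (hlead.mul h.deriv).congr (l := p * ((i + 1 : ℕ) : ℤ) - 1)
        (by push_cast; ring) rfl
      have h2 := ((hlead.deriv.mul h).congr (l := p * ((i + 1 : ℕ) : ℤ) - 1)
        (by push_cast; ring) rfl).smul (1 / 2)
      have h3 := (h.deriv.deriv.deriv.mono (l := p * ((i + 1 : ℕ) : ℤ) - 1)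
        (by push_cast; linarith)).smul (1 / 4)
      have h4 := (h1.add h2).sub h3
      rw [← hR i] at h4
      have hpi : p * ((i + 1 : ℕ) : ℤ) < 0 := by
        have : (0 : ℤ) < ((i + 1 : ℕ) : ℤ) := by positivity
        nlinarith
      refine ⟨_, ?_, h4.of_deriv hpi.ne fun h => absurd h hpi.le.not_gt⟩
      have hp0 : (p : ℂ) ≠ 0 := by
        have : p ≠ 0 := by omega
        exact_mod_cast this
      refine div_ne_zero ?_ (by exact_mod_cast hpi.ne)
      have hi : (2 * i + 1 : ℂ) ≠ 0 := by
        exact_mod_cast (by omega : 2 * i + 1 ≠ 0)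
      have : u.coeff p * (((p * i : ℤ) : ℂ) * r) + 1 / 2 * ((p : ℂ) * u.coeff p * r) -
          1 / 4 * 0 = u.coeff p * p * r * (2 * i + 1) / 2 := by
        push_cast
        ring
      rw [this]
      exact div_ne_zero (mul_ne_zero (mul_ne_zero (mul_ne_zero ha hp0) hr) hi) two_ne_zero
  obtain ⟨r, hr, h⟩ := key n
  rw [hn] at h
  exact hr h.eq_zero_of_zero

/-- The leading coefficients of the solution of the recursion for the potential `c / T ^ 2`. -/
def leadCoeff (c : ℂ) : ℕ → ℂ
  | 0 => 1
  | i + 1 => leadCoeff c i * ((2 * i + 1) * (c - i * (i + 1))) / (2 * (i + 1))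

theorem IsResolvent.isLead (hR : IsResolvent u R) (h0 : R 0 = 1) {c : ℂ} (hu : IsLead u (-2) c)
    (i : ℕ) : IsLead (R i) (-2 * i) (leadCoeff c i) := by
  induction i with
  | zero => rw [h0]; exact isLead_one.congr (by simp) rfl
  | succ i h =>
    have h1 := (hu.mul h.deriv).congr (l := -2 * ((i + 1 : ℕ) : ℤ) - 1) (by push_cast; ring) rfl
    have h2 := ((hu.deriv.mul h).congr (l := -2 * ((i + 1 : ℕ) : ℤ) - 1)
      (by push_cast; ring) rfl).smul (1 / 2)
    have h3 := (h.deriv.deriv.deriv.congr (l := -2 * ((i + 1 : ℕ) : ℤ) - 1)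
      (by push_cast; ring) rfl).smul (1 / 4)
    have h4 := (h1.add h2).sub h3
    rw [← hR i] at h4
    refine (h4.of_deriv (by omega) (by omega)).congr rfl ?_
    rw [leadCoeff]
    have hi : ((i : ℂ) + 1) ≠ 0 := by exact_mod_cast i.succ_ne_zero
    push_cast
    field_simp
    ring

theorem exists_coeff_eq_mul_succ (hR : IsResolvent u R) (h0 : R 0 = 1) (hn : R (n + 1) = 0) :
    ∃ m ≤ n, u.coeff (-2) = m * (m + 1) := by
  by_contra! hcon
  have hu : IsLead u (-2) (u.coeff (-2)) :=
    ⟨fun j hj => coeff_eq_zero_of_lt_neg_two hR h0 hn hj, rfl⟩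
  have key : ∀ i ≤ n + 1, leadCoeff (u.coeff (-2)) i ≠ 0 := by
    intro i
    induction i with
    | zero => exact fun _ => one_ne_zero
    | succ i ih =>
      intro hi
      rw [leadCoeff]
      refine div_ne_zero (mul_ne_zero (ih (by omega)) (mul_ne_zero ?_ ?_)) ?_
      · exact_mod_cast (by omega : 2 * i + 1 ≠ 0)
      · exact sub_ne_zero.2 (hcon i (by omega))
      · exact_mod_cast (by omega : 2 * (i + 1) ≠ 0)
  have h := hR.isLead h0 hu (n + 1)
  rw [hn] at h
  exact key _ le_rfl h.eq_zero_of_zero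

theorem leadCoeff_pos {m : ℕ} : ∀ i ≤ m, ∃ q : ℝ, 0 < q ∧ leadCoeff (m * (m + 1)) i = q := by
  intro i
  induction i with
  | zero => exact fun _ => ⟨1, one_pos, by simp [leadCoeff]⟩
  | succ i ih =>
    intro hi
    obtain ⟨q, hq, e⟩ := ih (by omega)
    refine ⟨q * ((2 * i + 1) * (m * (m + 1) - i * (i + 1))) / (2 * (i + 1)), ?_, ?_⟩
    · have h1 : (i : ℝ) + 1 ≤ m := by exact_mod_cast hi
      have h2 : (0 : ℝ) ≤ i := i.cast_nonneg
      have h3 : (0 : ℝ) < m * (m + 1) - i * (i + 1) := by nlinarith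
      positivity
    · rw [leadCoeff, e]
      push_cast
      ring

theorem leadCoeff_eq_zero {m : ℕ} : ∀ i, m < i → leadCoeff (m * (m + 1)) i = 0 := by
  intro i hi
  induction i, hi using Nat.le_induction with
  | base => simp [leadCoeff]
  | succ i _ ih => simp [leadCoeff, ih]

/-- Nonvanishing of the leading coefficients of the odd parts, see
`IsResolvent.isLead_sub`; `d T ^ (2 r - 1)` is twice the odd part of the potential, to leading
order. -/
theorem oddCoeff_ne_zero {m r : ℕ} (hrm : r ≤ m) {d : ℂ} (hd : d ≠ 0) {o : ℕ → ℂ}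
    (ho : ∀ i : ℕ, (2 * ((i : ℂ) - r) + 1) * o (i + 1) =
      2 * (i - r) * ((m + 1 / 2) ^ 2 - (i - r) ^ 2) * o i +
        d * leadCoeff (m * (m + 1)) i * (2 * i + 1 / 2 - r)) (i : ℕ) (hi : r < i) :
    o i ≠ 0 := by
  -- as long as `i ≤ m`, all terms of the recursion are nonnegative multiples of `d`
  have h1 : ∀ i, r < i → i ≤ m + 1 → ∃ t : ℝ, 0 < t ∧ o i = d * t := by
    intro i hi
    induction i, hi using Nat.le_induction with
    | base =>
      intro _
      obtain ⟨q, hq, e⟩ := leadCoeff_pos (m := m) r hrm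
      refine ⟨q * (r + 1 / 2), by positivity, ?_⟩
      have h := ho r
      rw [e, sub_self] at h
      push_cast
      linear_combination h
    | succ i hi ih =>
      intro hi'
      obtain ⟨q, hq, e⟩ := leadCoeff_pos (m := m) i (by omega)
      obtain ⟨t, ht, et⟩ := ih (by omega)
      have h := ho i
      rw [e, et] at h
      have c1 : (r : ℝ) + 1 ≤ i := by exact_mod_cast hi
      have c2 : (i : ℝ) ≤ m := by exact_mod_cast (by omega : i ≤ m)
      have c0 : (0 : ℝ) ≤ r := r.cast_nonneg
      have c3 : (0 : ℝ) < 2 * (i - r) + 1 := by linarith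
      have c4 : (0 : ℝ) < i - r := by linarith
      have c5 : (0 : ℝ) < (m + 1 / 2) ^ 2 - (i - r) ^ 2 := by nlinarith
      have c6 : (0 : ℝ) < 2 * i + 1 / 2 - r := by linarith
      refine ⟨(2 * (i - r) * ((m + 1 / 2) ^ 2 - (i - r) ^ 2) * t + q * (2 * i + 1 / 2 - r)) /
        (2 * (i - r) + 1), by positivity, ?_⟩
      have c7 : (2 * ((i : ℂ) - r) + 1) ≠ 0 := by exact_mod_cast c3.ne'
      push_cast
      rw [← mul_div_assoc, eq_div_iff c7]
      linear_combination h
  rcases le_or_gt i (m + 1) with him | him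
  · obtain ⟨t, ht, e⟩ := h1 i hi him
    rw [e]
    exact mul_ne_zero hd (by exact_mod_cast ht.ne')
  · -- beyond that the inhomogeneous term vanishes, and the factor of `o i` has no integer root
    induction i, him.le using Nat.le_induction with
    | base => exact absurd him (lt_irrefl _)
    | succ i hi' ih =>
      have hoi : o i ≠ 0 := by
        rcases hi'.eq_or_lt with rfl | hlt
        · obtain ⟨t, ht, e⟩ := h1 (m + 1) (by omega) le_rfl
          rw [e]
          exact mul_ne_zero hd (by exact_mod_cast ht.ne')
        · exact ih (by omega) hlt
      have h := ho i
      rw [leadCoeff_eq_zero i (by omega), mul_zero, zero_mul, add_zero] at h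
      intro h0
      rw [h0, mul_zero] at h
      refine mul_ne_zero (mul_ne_zero (mul_ne_zero two_ne_zero ?_) ?_) hoi h.symm
      · exact sub_ne_zero.2 (by exact_mod_cast (by omega : (i : ℕ) ≠ r))
      · intro h2
        have h3 : ((2 * (m : ℤ) + 1) ^ 2 : ℤ) = (2 * ((i : ℤ) - r)) ^ 2 := by
          have : ((2 * (m : ℂ) + 1) ^ 2 : ℂ) = (2 * ((i : ℂ) - r)) ^ 2 := by
            linear_combination 4 * h2
          exact_mod_cast this
        rcases sq_eq_sq_iff_eq_or_eq_neg.1 h3 with h4 | h4 <;> omega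

/-- Two solutions of the recursion with reflected potentials: the leading terms of their
differences, which contain odd powers only. -/
theorem IsResolvent.isLead_sub {v : ℂ⸨X⸩} {S : ℕ → ℂ⸨X⸩} (hR : IsResolvent u R)
    (hS : IsResolvent v S) (hR0 : R 0 = 1) (hS0 : S 0 = 1)
    (hodd : ∀ i k, (S i).coeff k = (-1) ^ k * (R i).coeff k) {c d : ℂ} {r : ℕ}
    (hu : IsLead u (-2) c) (hv : IsLead v (-2) c) (huv : IsLead (u - v) (2 * r - 1) d) :
    ∃ o : ℕ → ℂ, (∀ i, IsLead (R i - S i) (2 * r + 1 - 2 * i) (o i)) ∧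
      ∀ i : ℕ, (2 * ((i : ℂ) - r) + 1) * o (i + 1) =
        2 * (i - r) * ((c + 1 / 4) - (i - r) ^ 2) * o i +
          d * leadCoeff c i * (2 * i + 1 / 2 - r) := by
  have step : ∀ (i : ℕ) (a : ℂ), IsLead (R i - S i) (2 * r + 1 - 2 * i) a →
      IsLead (R (i + 1) - S (i + 1)) (2 * r + 1 - 2 * ((i + 1 : ℕ) : ℤ))
        ((2 * (i - r) * ((c + 1 / 4) - (i - r) ^ 2) * a +
          d * leadCoeff c i * (2 * i + 1 / 2 - r)) / (2 * ((i : ℂ) - r) + 1)) := by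
    intro i a h
    have hq := hR.isLead hR0 hu i
    have e : formalD (R (i + 1) - S (i + 1)) =
        ((u - v) * formalD (R i) + v * formalD (R i - S i)) +
          (1 / 2 : ℂ) • (formalD (u - v) * R i + formalD v * (R i - S i)) -
          (1 / 4 : ℂ) • formalD (formalD (formalD (R i - S i))) := by
      simp only [map_sub, hR i, hS i, sub_mul, mul_sub, smul_sub, smul_add]
      abel
    have hk : ∀ {x : ℂ⸨X⸩} {k : ℤ} {b : ℂ}, IsLead x k b → k = 2 * r - 2 * i - 2 →
        IsLead x (2 * r + 1 - 2 * ((i + 1 : ℕ) : ℤ) - 1) b := by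
      intro x k b hx hk
      exact hx.congr (by rw [hk]; push_cast; ring) rfl
    have h1 := hk (huv.mul hq.deriv) (by ring)
    have h2 := hk (hv.mul h.deriv) (by ring)
    have h3 := hk (huv.deriv.mul hq) (by ring)
    have h4 := hk (hv.deriv.mul h) (by ring)
    have h5 := hk h.deriv.deriv.deriv (by ring)
    have h6 := ((h1.add h2).add ((h3.add h4).smul (1 / 2))).sub (h5.smul (1 / 4))
    rw [← e] at h6
    refine (h6.of_deriv (by omega) fun _ => ?_).congr rfl ?_
    · rw [HahnSeries.coeff_sub, hodd]
      simp
    · have c1 : (2 * ((i : ℂ) - r) + 1) ≠ 0 := by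
        exact_mod_cast (by omega : 2 * ((i : ℤ) - r) + 1 ≠ 0)
      have c2 : ((2 * r + 1 - 2 * ((i + 1 : ℕ) : ℤ) : ℤ) : ℂ) = -(2 * ((i : ℂ) - r) + 1) := by
        push_cast
        ring
      rw [c2, div_neg, ← neg_div]
      congr 1
      push_cast
      ring
  let o : ℕ → ℂ := fun i => Nat.rec 0 (fun i a =>
    (2 * ((i : ℂ) - r) * ((c + 1 / 4) - (i - r) ^ 2) * a +
      d * leadCoeff c i * (2 * i + 1 / 2 - r)) / (2 * ((i : ℂ) - r) + 1)) i
  refine ⟨o, fun i => ?_, fun i => ?_⟩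
  · induction i with
    | zero =>
      rw [hR0, hS0, sub_self]
      exact ⟨fun _ _ => HahnSeries.coeff_zero, HahnSeries.coeff_zero⟩
    | succ i ih => exact step i _ ih
  · have c1 : (2 * ((i : ℂ) - r) + 1) ≠ 0 := by
      exact_mod_cast (by omega : 2 * ((i : ℤ) - r) + 1 ≠ 0)
    exact mul_div_cancel₀ _ c1

/-- The vanishing of the odd coefficients in the trivial monodromy conditions. Here `v` and `S` are
the reflections of `u` and `R`. -/
theorem coeff_odd_eq_zero {v : ℂ⸨X⸩} {S : ℕ → ℂ⸨X⸩} (hR : IsResolvent u R)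
    (hS : IsResolvent v S) (hR0 : R 0 = 1) (hS0 : S 0 = 1) (hn : R (n + 1) = 0)
    (hodd : ∀ i k, (S i).coeff k = (-1) ^ k * (R i).coeff k)
    (hv : ∀ k, v.coeff k = (-1) ^ k * u.coeff k) {m : ℕ} (hm : u.coeff (-2) = m * (m + 1))
    (hmn : m ≤ n) (r : ℕ) (hr : r ≤ m) : u.coeff (2 * r - 1) = 0 := by
  induction r using Nat.strong_induction_on with
  | _ r ih =>
    by_contra hne
    have h1 : ∀ k < -2, u.coeff k = 0 := fun k hk => coeff_eq_zero_of_lt_neg_two hR hR0 hn hk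
    have hlu : IsLead u (-2) (m * (m + 1)) := ⟨h1, hm⟩
    have hlv : IsLead v (-2) (m * (m + 1)) :=
      ⟨fun k hk => by rw [hv, h1 k hk, mul_zero], by rw [hv, hm]; norm_num⟩
    have hodd1 : (-1 : ℂ) ^ (2 * (r : ℤ) - 1) = -1 := Odd.neg_one_zpow ⟨r - 1, by ring⟩
    have hluv : IsLead (u - v) (2 * r - 1) (2 * u.coeff (2 * r - 1)) := by
      refine ⟨fun k hk => ?_, ?_⟩
      · rw [HahnSeries.coeff_sub, hv]
        rcases Int.even_or_odd k with he | ho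
        · rw [he.neg_one_zpow, one_mul, sub_self]
        · rcases lt_or_ge k (-2) with hlt | hge
          · rw [h1 k hlt, mul_zero, sub_zero]
          · obtain ⟨j, hj⟩ := ho
            have hj' : k = 2 * ((j + 1).toNat : ℤ) - 1 := by omega
            rw [hj', ih (j + 1).toNat (by omega) (by omega), mul_zero, sub_zero]
      · rw [HahnSeries.coeff_sub, hv, hodd1]
        ring
    obtain ⟨o, ho, ho'⟩ := hR.isLead_sub hS hR0 hS0 hodd hlu hlv hluv
    have h2 := oddCoeff_ne_zero hr (mul_ne_zero two_ne_zero hne) (o := o)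
      (fun i => by rw [ho' i]; ring) (n + 1) (by omega)
    apply h2
    rw [← (ho (n + 1)).2, HahnSeries.coeff_sub, hodd, hn]
    simp

/-! ### Ordinary differential operators with meromorphic coefficients -/

theorem mulOp_mul (a : Mer) (T : Module.End ℂ Mer) : mulOp a * T = a • T := rfl

theorem D_mul_smul (a : Mer) (T : Module.End ℂ Mer) :
    D * (a • T) = D a • T + a • (D * T) := by
  ext x
  exact D_mul a (T x)

theorem smul_mul_end (a : Mer) (S T : Module.End ℂ Mer) : (a • S) * T = a • (S * T) := rfl

theorem D_coordinate_pow (j : ℕ) : D (coordinate ^ (j + 1)) = (j + 1) • coordinate ^ j := by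
  induction j with
  | zero => simp [D_coordinate]
  | succ j ih =>
    rw [pow_succ, D_mul, ih, D_coordinate, nsmul_eq_mul, nsmul_eq_mul]
    push_cast
    ring

theorem D_pow_coordinate_pow (j : ℕ) : (D ^ j) (coordinate ^ j) = ((j.factorial : ℕ) : Mer) := by
  induction j with
  | zero => simp
  | succ j ih =>
    rw [pow_succ D, Module.End.mul_apply, D_coordinate_pow, map_nsmul, ih, Nat.factorial_succ,
      nsmul_eq_mul]
    push_cast
    ring

theorem D_one : D 1 = 0 := by simpa using D_algebraMap 1

theorem D_pow_coordinate_pow_of_lt {i j : ℕ} (h : j < i) : (D ^ i) (coordinate ^ j) = 0 := by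
  induction j generalizing i with
  | zero =>
    obtain ⟨k, rfl⟩ := Nat.exists_eq_add_of_lt h
    rw [pow_zero, pow_succ D, Module.End.mul_apply, D_one, map_zero]
  | succ j ih =>
    obtain ⟨k, rfl⟩ := Nat.exists_eq_succ_of_ne_zero (by omega : i ≠ 0)
    rw [pow_succ D, Module.End.mul_apply, D_coordinate_pow, map_nsmul, ih (by omega), smul_zero]

/-- The powers of `D` are linearly independent over the meromorphic functions. -/
theorem eq_zero_of_sum_smul_D_pow {k : ℕ} {c : ℕ → Mer}
    (h : ∑ i ∈ Finset.range k, c i • D ^ i = 0) : ∀ j < k, c j = 0 := by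
  intro j
  induction j using Nat.strong_induction_on with
  | _ j ih =>
    intro hj
    have h1 := LinearMap.congr_fun h (coordinate ^ j)
    rw [LinearMap.sum_apply, Finset.sum_eq_single j] at h1
    · rw [LinearMap.smul_apply, D_pow_coordinate_pow, smul_eq_mul, mul_comm, ← nsmul_eq_mul,
        ← Nat.cast_smul_eq_nsmul ℂ, LinearMap.zero_apply] at h1
      exact (smul_eq_zero.1 h1).resolve_left (Nat.cast_ne_zero.2 j.factorial_ne_zero)
    · intro i hi hij
      rcases lt_or_gt_of_ne hij with hlt | hgt
      · rw [ih i hlt (hlt.trans hj), zero_smul, LinearMap.zero_apply]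
      · rw [LinearMap.smul_apply, D_pow_coordinate_pow_of_lt hgt, smul_zero]
    · exact fun hj' => absurd (Finset.mem_range.2 hj) hj'

/-- The operators `∑ c_i b_i`, `i < k`, with meromorphic coefficients. -/
def operatorSpan (b : ℕ → Module.End ℂ Mer) (k : ℕ) : Submodule Mer (Module.End ℂ Mer) :=
  Submodule.span Mer (b '' (Finset.range k : Set ℕ))

variable {b : ℕ → Module.End ℂ Mer} {k l : ℕ}

theorem mem_operatorSpan {T : Module.End ℂ Mer} :
    T ∈ operatorSpan b k ↔ ∃ c : ℕ → Mer, ∑ i ∈ Finset.range k, c i • b i = T := by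
  refine (Submodule.mem_span_image_finset_iff_exists_fun Mer).trans ⟨?_, ?_⟩
  · rintro ⟨c, rfl⟩
    refine ⟨fun i => if h : i ∈ Finset.range k then c ⟨i, h⟩ else 0, ?_⟩
    rw [← Finset.sum_coe_sort]
    exact Finset.sum_congr rfl fun i _ => by simp only [dif_pos i.2]
  · rintro ⟨c, rfl⟩
    exact ⟨fun i => c i, Finset.sum_coe_sort (Finset.range k) fun i => c i • b i⟩

theorem operatorSpan_mono (h : k ≤ l) : operatorSpan b k ≤ operatorSpan b l :=
  Submodule.span_mono (Set.image_mono (by simpa using h))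

theorem self_mem_operatorSpan (h : k < l) : b k ∈ operatorSpan b l :=
  Submodule.subset_span ⟨k, by simpa using h, rfl⟩

theorem D_mul_mem_operatorSpan (hb : ∀ i, D * b i ∈ operatorSpan b (i + 2))
    {T : Module.End ℂ Mer} (hT : T ∈ operatorSpan b k) : D * T ∈ operatorSpan b (k + 1) := by
  obtain ⟨c, rfl⟩ := mem_operatorSpan.1 hT
  rw [Finset.mul_sum]
  refine Submodule.sum_mem _ fun i hi => ?_
  have hik := Finset.mem_range.1 hi
  rw [D_mul_smul]
  exact Submodule.add_mem _ (Submodule.smul_mem _ _ (self_mem_operatorSpan (by omega)))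
    (Submodule.smul_mem _ _ (operatorSpan_mono (by omega) (hb i)))

theorem D_mul_D_pow_mem (i : ℕ) : D * D ^ i ∈ operatorSpan (D ^ ·) (i + 2) := by
  rw [← pow_succ']
  exact self_mem_operatorSpan (b := (D ^ ·)) (by omega)

/-- The operators `1, D, M, D M, M ^ 2, D M ^ 2, …` with `M = D ^ 2 - u`. -/
def schrodingerBasis (u : Mer) (i : ℕ) : Module.End ℂ Mer :=
  D ^ (i % 2) * (-schrodinger u) ^ (i / 2)

theorem schrodingerBasis_even (u : Mer) (j : ℕ) :
    schrodingerBasis u (2 * j) = (-schrodinger u) ^ j := by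
  simp [schrodingerBasis]

theorem schrodingerBasis_odd (u : Mer) (j : ℕ) :
    schrodingerBasis u (2 * j + 1) = D * (-schrodinger u) ^ j := by
  rw [schrodingerBasis, show (2 * j + 1) % 2 = 1 by omega, show (2 * j + 1) / 2 = j by omega,
    pow_one]

theorem neg_schrodinger_mul (u : Mer) (T : Module.End ℂ Mer) :
    -schrodinger u * T = D * (D * T) - u • T := by
  have h : -mulOp u * T = -(u • T) := neg_mul (mulOp u) T
  rw [schrodinger, neg_add, neg_neg, add_mul, pow_two, mul_assoc, h, sub_eq_add_neg]

theorem D_mul_D_mul (u : Mer) (T : Module.End ℂ Mer) :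
    D * (D * T) = -schrodinger u * T + u • T := by
  rw [neg_schrodinger_mul, sub_add_cancel]

theorem D_mul_schrodingerBasis_even (u : Mer) (j : ℕ) :
    D * schrodingerBasis u (2 * j) = schrodingerBasis u (2 * j + 1) := by
  rw [schrodingerBasis_even, schrodingerBasis_odd]

theorem D_mul_schrodingerBasis_odd (u : Mer) (j : ℕ) :
    D * schrodingerBasis u (2 * j + 1) =
      schrodingerBasis u (2 * j + 2) + u • schrodingerBasis u (2 * j) := by
  rw [schrodingerBasis_odd, D_mul_D_mul u, schrodingerBasis_even, ← pow_succ',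
    ← schrodingerBasis_even u (j + 1)]
  rfl

theorem D_mul_schrodingerBasis_mem (u : Mer) (i : ℕ) :
    D * schrodingerBasis u i ∈ operatorSpan (schrodingerBasis u) (i + 2) := by
  rcases Nat.even_or_odd' i with ⟨j, rfl | rfl⟩
  · rw [D_mul_schrodingerBasis_even]
    exact self_mem_operatorSpan (by omega)
  · rw [D_mul_schrodingerBasis_odd]
    exact Submodule.add_mem _ (self_mem_operatorSpan (by omega))
      (Submodule.smul_mem _ _ (self_mem_operatorSpan (by omega)))

theorem D_pow_mem_operatorSpan (u : Mer) (k : ℕ) :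
    D ^ k ∈ operatorSpan (schrodingerBasis u) (k + 1) := by
  induction k with
  | zero =>
    have h : (D ^ 0 : Module.End ℂ Mer) = schrodingerBasis u 0 := by simp [schrodingerBasis]
    rw [h]
    exact self_mem_operatorSpan (by omega)
  | succ k ih =>
    rw [pow_succ']
    exact D_mul_mem_operatorSpan (D_mul_schrodingerBasis_mem u) ih

theorem schrodingerBasis_sub_mem (u : Mer) (k : ℕ) :
    schrodingerBasis u k - D ^ k ∈ operatorSpan (D ^ ·) k := by
  induction k using Nat.strong_induction_on with
  | _ k ih =>
    rcases k with _ | k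
    · simp [schrodingerBasis]
    have h1 : D * schrodingerBasis u k - D ^ (k + 1) ∈ operatorSpan (D ^ ·) (k + 1) := by
      rw [pow_succ', ← mul_sub]
      exact D_mul_mem_operatorSpan D_mul_D_pow_mem (ih k (by omega))
    rcases Nat.even_or_odd' k with ⟨j, rfl | rfl⟩
    · rwa [D_mul_schrodingerBasis_even] at h1
    · rw [D_mul_schrodingerBasis_odd] at h1
      have h2 : schrodingerBasis u (2 * j) ∈ operatorSpan (D ^ ·) (2 * j + 1 + 1) := by
        have h3 := Submodule.add_mem _
          (operatorSpan_mono (by omega : 2 * j ≤ 2 * j + 1 + 1) (ih (2 * j) (by omega)))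
          (self_mem_operatorSpan (b := (D ^ ·)) (by omega : 2 * j < 2 * j + 1 + 1))
        rwa [sub_add_cancel] at h3
      have h4 := Submodule.sub_mem _ h1 (Submodule.smul_mem _ u h2)
      rwa [add_sub_right_comm, add_sub_cancel_right] at h4

/-- Operators of order less than `k` are the same in terms of `D ^ i` and of
`schrodingerBasis u`. -/
theorem operatorSpan_schrodingerBasis (u : Mer) (k : ℕ) :
    operatorSpan (schrodingerBasis u) k = operatorSpan (D ^ ·) k := by
  apply le_antisymm
  · refine Submodule.span_le.2 ?_
    rintro _ ⟨i, hi, rfl⟩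
    have hik : i < k := by simpa using hi
    have h := Submodule.add_mem _ (operatorSpan_mono hik.le (schrodingerBasis_sub_mem u i))
      (self_mem_operatorSpan (b := (D ^ ·)) hik)
    rwa [sub_add_cancel] at h
  · refine Submodule.span_le.2 ?_
    rintro _ ⟨i, hi, rfl⟩
    have hik : i < k := by simpa using hi
    exact operatorSpan_mono hik (D_pow_mem_operatorSpan u i)

theorem eq_zero_of_sum_smul_schrodingerBasis {u : Mer} {c : ℕ → Mer} :
    ∀ {k : ℕ}, ∑ i ∈ Finset.range k, c i • schrodingerBasis u i = 0 → ∀ i < k, c i = 0 := by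
  intro k
  induction k with
  | zero => exact fun _ i hi => absurd hi (Nat.not_lt_zero i)
  | succ k ih =>
    intro h
    rw [Finset.sum_range_succ] at h
    have hk : c k = 0 := by
      have h1 : ∑ i ∈ Finset.range k, c i • schrodingerBasis u i +
          c k • (schrodingerBasis u k - D ^ k) ∈ operatorSpan (D ^ ·) k := by
        refine Submodule.add_mem _ ?_ (Submodule.smul_mem _ _ (schrodingerBasis_sub_mem u k))
        rw [← operatorSpan_schrodingerBasis u]
        exact mem_operatorSpan.2 ⟨c, rfl⟩
      obtain ⟨a, ha⟩ := mem_operatorSpan.1 h1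
      have h2 : ∑ i ∈ Finset.range (k + 1), (if i = k then c k else a i) • D ^ i = 0 := by
        rw [Finset.sum_range_succ, if_pos rfl, ← h]
        have h3 : ∑ i ∈ Finset.range k, (if i = k then c k else a i) • D ^ i =
            ∑ i ∈ Finset.range k, a i • D ^ i :=
          Finset.sum_congr rfl fun i hi => by rw [if_neg (Finset.mem_range.1 hi).ne]
        rw [h3, ha, smul_sub]
        abel
      simpa using eq_zero_of_sum_smul_D_pow h2 k (by omega)
    rw [hk, zero_smul, add_zero] at h
    intro i hi
    rcases Nat.lt_succ_iff_lt_or_eq.1 hi with h1 | rfl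
    · exact ih h i h1
    · exact hk

theorem sum_range_two_mul {M : Type*} [AddCommMonoid M] (f : ℕ → M) (n : ℕ) :
    ∑ i ∈ Finset.range (2 * n), f i = ∑ j ∈ Finset.range n, (f (2 * j) + f (2 * j + 1)) := by
  induction n with
  | zero => simp
  | succ n ih =>
    rw [Finset.sum_range_succ, ← ih, show 2 * (n + 1) = 2 * n + 1 + 1 by ring,
      Finset.sum_range_succ, Finset.sum_range_succ, add_assoc]

/-- Division of an odd order operator by `M = D ^ 2 - u`: the remainders `P_j + Q_j D`. -/
theorem oddOperator_eq_sum (u : Mer) (n : ℕ) (a : Fin (2 * n) → Mer) :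
    ∃ P Q : ℕ → Mer, Q n = 1 ∧ oddOperator n a = ∑ j ∈ Finset.range (n + 1),
      (P j • (-schrodinger u) ^ j + Q j • (D * (-schrodinger u) ^ j)) := by
  have h1 : oddOperator n a - schrodingerBasis u (2 * n + 1) ∈
      operatorSpan (schrodingerBasis u) (2 * n + 1) := by
    rw [operatorSpan_schrodingerBasis, oddOperator, add_sub_right_comm, ← neg_sub]
    refine Submodule.add_mem _ (Submodule.neg_mem _ (schrodingerBasis_sub_mem u _))
      (Submodule.sum_mem _ fun j _ => ?_)
    rw [mulOp_mul]
    exact Submodule.smul_mem _ _ (self_mem_operatorSpan (b := (D ^ ·)) (by omega))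
  obtain ⟨c, hc⟩ := mem_operatorSpan.1 h1
  let c' : ℕ → Mer := fun i => if i = 2 * n + 1 then 1 else c i
  refine ⟨fun j => c' (2 * j), fun j => c' (2 * j + 1), by simp [c'], ?_⟩
  have h2 := sum_range_two_mul (fun i => c' i • schrodingerBasis u i) (n + 1)
  simp only [schrodingerBasis_even, schrodingerBasis_odd] at h2
  rw [← h2, show 2 * (n + 1) = 2 * n + 1 + 1 by ring, Finset.sum_range_succ]
  have h3 : ∑ i ∈ Finset.range (2 * n + 1), c' i • schrodingerBasis u i =
      ∑ i ∈ Finset.range (2 * n + 1), c i • schrodingerBasis u i :=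
    Finset.sum_congr rfl fun i hi => by simp only [c', if_neg (Finset.mem_range.1 hi).ne]
  rw [h3, hc]
  simp [c']

/-- The term `[M, (P + Q D) M ^ j]` of the commutator, expanded in the basis `M ^ j`, `D M ^ j`. -/
theorem commutator_term (u P Q : Mer) (j : ℕ) :
    -schrodinger u * (P • (-schrodinger u) ^ j + Q • (D * (-schrodinger u) ^ j)) -
      (P • (-schrodinger u) ^ j + Q • (D * (-schrodinger u) ^ j)) * -schrodinger u =
    (D (D P) + Q * D u + 2 * (u * D Q)) • (-schrodinger u) ^ j +
      (D (D Q) + 2 * D P) • (D * (-schrodinger u) ^ j) +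
        (2 * D Q) • (-schrodinger u) ^ (j + 1) := by
  have h1 : (P • (-schrodinger u) ^ j + Q • (D * (-schrodinger u) ^ j)) * -schrodinger u =
      P • (-schrodinger u * (-schrodinger u) ^ j) +
        Q • (D * (-schrodinger u * (-schrodinger u) ^ j)) := by
    rw [add_mul, smul_mul_end, smul_mul_end, mul_assoc, ← pow_succ, ← pow_succ']
  rw [h1, pow_succ', neg_schrodinger_mul u (_ + _)]
  generalize hT : (-schrodinger u) ^ j = T
  have h2 := D_mul_D_mul u T
  simp only [mul_add, D_mul_smul, h2, smul_add, smul_smul, D_mul, add_smul]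
  module

/-- A finite-gap potential has a solution `R` of the recursion that terminates: up to sign and
order, the `R i` are the coefficients of `D` in the expansion of the commuting operator. -/
theorem IsFiniteGap.exists_recursion {u : Mer} (hu : IsFiniteGap u) :
    ∃ (n : ℕ) (R : ℕ → Mer), R 0 = 1 ∧ R (n + 1) = 0 ∧
      ∀ i, 4 * D (R (i + 1)) = 4 * (u * D (R i)) + 2 * (D u * R i) - D (D (D (R i))) := by
  obtain ⟨n, a, hcomm⟩ := hu
  obtain ⟨P, Q, hQ, hA⟩ := oddOperator_eq_sum u n a
  have hM : -schrodinger u * oddOperator n a - oddOperator n a * -schrodinger u = 0 := by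
    have h : Commute (-schrodinger u) (oddOperator n a) := Commute.neg_left hcomm
    rw [h.eq, sub_self]
  -- the coefficients of `M A - A M` in the basis
  let e : ℕ → Mer := fun j => D (D (P j)) + Q j * D u + 2 * (u * D (Q j)) +
    if j = 0 then 0 else 2 * D (Q (j - 1))
  let e' : ℕ → Mer := fun j => D (D (Q j)) + 2 * D (P j)
  have hsum : ∑ j ∈ Finset.range (n + 1),
      (e j • (-schrodinger u) ^ j + e' j • (D * (-schrodinger u) ^ j)) = 0 := by
    rw [← hM, hA, Finset.mul_sum, Finset.sum_mul, ← Finset.sum_sub_distrib]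
    simp only [commutator_term, e, e', add_smul _ (ite _ _ _), Finset.sum_add_distrib]
    have h1 : ∑ j ∈ Finset.range (n + 1),
        (if j = 0 then 0 else 2 * D (Q (j - 1)) : Mer) • (-schrodinger u) ^ j =
        ∑ j ∈ Finset.range (n + 1), (2 * D (Q j)) • (-schrodinger u) ^ (j + 1) := by
      rw [Finset.sum_range_succ', Finset.sum_range_succ, hQ, D_one]
      simp
    rw [h1]
    abel
  let c : ℕ → Mer := fun i => if i % 2 = 0 then e (i / 2) else e' (i / 2)
  have hce : ∀ j, c (2 * j) = e j := fun j => by simp [c]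
  have hco : ∀ j, c (2 * j + 1) = e' j := fun j => by
    simp only [c]
    rw [if_neg (by omega), show (2 * j + 1) / 2 = j by omega]
  have hc : ∑ i ∈ Finset.range (2 * (n + 1)), c i • schrodingerBasis u i = 0 := by
    rw [sum_range_two_mul]
    simpa only [hce, hco, schrodingerBasis_even, schrodingerBasis_odd] using hsum
  have he : ∀ j ≤ n, e j = 0 := fun j hj => by
    rw [← hce]
    exact eq_zero_of_sum_smul_schrodingerBasis hc _ (by omega)
  have he' : ∀ j ≤ n, D (D (Q j)) + 2 * D (P j) = 0 := fun j hj => by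
    change e' j = 0
    rw [← hco]
    exact eq_zero_of_sum_smul_schrodingerBasis hc _ (by omega)
  have hP : ∀ j ≤ n, D (D (D (Q j))) + 2 * D (D (P j)) = 0 := fun j hj => by
    have h := congrArg D (he' j hj)
    rwa [map_add, map_zero, two_mul, map_add, ← two_mul] at h
  have hD : ∀ (i : ℕ) (x : Mer), D ((-1) ^ i * x) = (-1) ^ i * D x := by
    intro i x
    rcases neg_one_pow_eq_or Mer i with h | h <;> simp [h]
  refine ⟨n, fun i => if i ≤ n then (-1) ^ i * Q (n - i) else 0, by simp [hQ], by simp,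
    fun i => ?_⟩
  rcases lt_trichotomy i n with hi | rfl | hi
  · have h1 := he (n - i) (by omega)
    simp only [e, if_neg (by omega : n - i ≠ 0)] at h1
    rw [show n - i - 1 = n - (i + 1) by omega] at h1
    have h2 := hP (n - i) (by omega)
    simp only [if_pos (by omega : i + 1 ≤ n), if_pos hi.le, hD]
    rw [pow_succ]
    linear_combination (-1) ^ i * (h2 - 2 * h1)
  · have h1 := he 0 (by omega)
    simp only [e, if_true, add_zero] at h1
    have h2 := hP 0 (by omega)
    simp only [if_neg (by omega : ¬ i + 1 ≤ i), if_pos le_rfl, hD, Nat.sub_self, map_zero]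
    linear_combination (-1) ^ i * (h2 - 2 * h1)
  · simp only [if_neg (by omega : ¬ i ≤ n), if_neg (by omega : ¬ i + 1 ≤ n), map_zero]
    ring

/-! ### Trivial monodromy conditions for finite-gap potentials -/

theorem eq_of_four_mul_eq {x y z w : ℂ⸨X⸩} (h : 4 * x = 4 * y + 2 * z - w) :
    x = y + (1 / 2 : ℂ) • z - (1 / 4 : ℂ) • w := by
  ext k
  have h1 := congrArg (fun v : ℂ⸨X⸩ => v.coeff k) h
  have h4 : ∀ v : ℂ⸨X⸩, 4 * v = v + v + v + v := fun v => by ring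
  simp only [h4, two_mul, HahnSeries.coeff_add, HahnSeries.coeff_sub] at h1
  simp only [HahnSeries.coeff_add, HahnSeries.coeff_sub, HahnSeries.coeff_smul, smul_eq_mul]
  linear_combination (1 / 4) * h1

theorem isResolvent_laurent {u : Mer} {R : ℕ → Mer} (z : ℂ)
    (h : ∀ i, 4 * D (R (i + 1)) = 4 * (u * D (R i)) + 2 * (D u * R i) - D (D (D (R i)))) :
    IsResolvent (laurent z u) fun i => laurent z (R i) := by
  intro i
  have h1 := congrArg (laurent z) (h i)
  simp only [map_sub, map_add, map_mul, map_ofNat, laurent_D] at h1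
  exact eq_of_four_mul_eq h1

/-- The reflections of a solution of the recursion solve the one of the reflected potential: each
term contains an odd number of derivatives. -/
theorem recursion_reflect {u : Mer} {R : ℕ → Mer} (z : ℂ)
    (h : ∀ i, 4 * D (R (i + 1)) = 4 * (u * D (R i)) + 2 * (D u * R i) - D (D (D (R i)))) (i : ℕ) :
    4 * D (reflect z (R (i + 1))) = 4 * (reflect z u * D (reflect z (R i))) +
      2 * (D (reflect z u) * reflect z (R i)) - D (D (D (reflect z (R i)))) := by
  have h1 := congrArg (reflect z) (h i)
  simp only [map_sub, map_add, map_mul, map_ofNat] at h1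
  simp only [D_reflect, map_neg]
  linear_combination -h1

/-- At every point, a finite-gap potential is `m (m + 1) / T ^ 2 + ∑ c_k T ^ k` with
`c_{-1} = c_1 = ⋯ = c_{2 m - 1} = 0`. -/
theorem IsFiniteGap.laurent_coeff {u : Mer} (hu : IsFiniteGap u) (z : ℂ) :
    (∀ k < -2, (laurent z u).coeff k = 0) ∧ ∃ m : ℕ, (laurent z u).coeff (-2) = m * (m + 1) ∧
      ∀ r ≤ m, (laurent z u).coeff (2 * r - 1) = 0 := by
  obtain ⟨n, R, hR0, hRn, hR⟩ := hu.exists_recursion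
  have h := isResolvent_laurent z hR
  have h0 : laurent z (R 0) = 1 := by rw [hR0, map_one]
  have hn : laurent z (R (n + 1)) = 0 := by rw [hRn, map_zero]
  refine ⟨fun k hk => coeff_eq_zero_of_lt_neg_two h h0 hn hk, ?_⟩
  obtain ⟨m, hmn, hm⟩ := exists_coeff_eq_mul_succ h h0 hn
  refine ⟨m, hm, coeff_odd_eq_zero h (isResolvent_laurent z (recursion_reflect z hR)) h0 ?_ hn
    (fun i k => coeff_laurent_reflect z (R i) k) (fun k => coeff_laurent_reflect z u k) hm hmn⟩
  rw [hR0, map_one, map_one]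

/-! ### Linear functionals on Zariski dense subsets -/

/-- If at each point of a Zariski dense set `K` either `c` vanishes or `ℓ` takes one of finitely
many values, then `c` or `ℓ` is zero. -/
theorem IsZariskiDense.functional_eq_zero {W : Type} [AddCommGroup W] [Module ℂ W] {K : Set W}
    (hK : IsZariskiDense K) {ℓ c : Module.Dual ℂ W} (hℓ : ℓ ≠ 0) (s : Finset ℂ)
    (h : ∀ w ∈ K, c w = 0 ∨ ℓ w ∈ s) : c = 0 := by
  let p : MvPolynomial (Module.Dual ℂ W) ℂ :=
    MvPolynomial.X c * ∏ a ∈ s, (MvPolynomial.X ℓ - MvPolynomial.C a)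
  have hp : ∀ w : W, MvPolynomial.eval (fun ℓ => ℓ w) p = c w * ∏ a ∈ s, (ℓ w - a) := by
    intro w
    simp [p, map_prod]
  have hall : ∀ w : W, c w = 0 ∨ ℓ w ∈ s := by
    intro w
    have h1 := hK p (fun w hw => ?_) w
    · rw [hp, mul_eq_zero, Finset.prod_eq_zero_iff] at h1
      refine h1.imp_right ?_
      rintro ⟨a, ha, e⟩
      rwa [sub_eq_zero.1 e]
    · rw [hp, mul_eq_zero, Finset.prod_eq_zero_iff]
      exact (h w hw).imp_right fun hw' => ⟨_, hw', sub_self _⟩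
  by_contra hc
  obtain ⟨x, hx⟩ : ∃ x, c x ≠ 0 := by
    by_contra! hcon
    exact hc (LinearMap.ext hcon)
  obtain ⟨y, hy⟩ : ∃ y, ℓ y ≠ 0 := by
    by_contra! hcon
    exact hℓ (LinearMap.ext hcon)
  -- on the line through `x` in the direction `y` only finitely many points are exceptional
  obtain ⟨t, ht⟩ := Infinite.exists_notMem_finset
    (insert (-(c x / c y)) (s.image fun a => (a - ℓ x) / ℓ y))
  rw [Finset.mem_insert, not_or] at ht
  rcases hall (x + t • y) with h1 | h1
  · rw [map_add, map_smul, smul_eq_mul] at h1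
    have hcy : c y ≠ 0 := by
      intro h0
      rw [h0, mul_zero, add_zero] at h1
      exact hx h1
    apply ht.1
    field_simp
    linear_combination h1
  · apply ht.2
    refine Finset.mem_image.2 ⟨_, h1, ?_⟩
    rw [map_add, map_smul, smul_eq_mul, add_sub_cancel_left, mul_div_cancel_right₀ _ hy]

/-- The `k`-th Laurent coefficient at `z`, as a functional on a space of meromorphic functions. -/
def coeffFunctional (V : Submodule ℂ Mer) (z : ℂ) (k : ℤ) : Module.Dual ℂ V where
  toFun u := (laurent z u).coeff k
  map_add' u v := by simp
  map_smul' c u := by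
    change (laurent z (c • (u : Mer))).coeff k = c * (laurent z u).coeff k
    rw [Algebra.smul_def, map_mul, AlgHom.commutes, LaurentSeries.algebraMap_apply,
      HahnSeries.C_mul_eq_smul, HahnSeries.coeff_smul, smul_eq_mul]

/-- All functions of a finite-gap subspace are even about a pole of one of them. -/
theorem IsFiniteGapSubspace.reflect_eq {V : Submodule ℂ Mer} (hV : IsFiniteGapSubspace V) {z : ℂ}
    {v : Mer} (hv : v ∈ V) (hz : HasPoleAt v z) {u : Mer} (hu : u ∈ V) : reflect z u = u := by
  obtain ⟨-, K, -, hK, hdense⟩ := hV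
  obtain ⟨k, hk, hvk⟩ := exists_coeff_laurent_ne_zero hz
  have hvk' : coeffFunctional V z k ≠ 0 := fun h => hvk (LinearMap.congr_fun h ⟨v, hv⟩)
  -- some `T ^ (-2)` coefficient is nonzero: otherwise `m = 0` on `K`, and nothing there has a pole
  have hℓ : coeffFunctional V z (-2) ≠ 0 := by
    intro h0
    refine hvk' (hdense.functional_eq_zero hvk' ∅ fun w hw => Or.inl ?_)
    obtain ⟨h1, m, -, h2⟩ := (hK w hw).laurent_coeff z
    rcases lt_trichotomy k (-2) with h | rfl | h
    · exact h1 k h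
    · exact LinearMap.congr_fun h0 w
    · have hk1 : k = 2 * ((0 : ℕ) : ℤ) - 1 := by
        push_cast
        omega
      rw [hk1]
      exact h2 0 (Nat.zero_le m)
  have hodd : ∀ j : ℤ, Odd j → coeffFunctional V z j = 0 := by
    intro j hj
    -- on `K` the coefficient of `T ^ j` is zero unless `m ≤ j`,
    -- which leaves finitely many values `m (m + 1)`
    refine hdense.functional_eq_zero hℓ
      ((Finset.range (j + 1).toNat).image fun m : ℕ => (m : ℂ) * (m + 1)) fun w hw => ?_
    obtain ⟨h1, m, hm, h2⟩ := (hK w hw).laurent_coeff z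
    rcases lt_or_ge j (-2) with h | h
    · exact Or.inl (h1 j h)
    obtain ⟨i, rfl⟩ := hj
    rcases le_or_gt ((i + 1).toNat) m with h3 | h3
    · left
      have h4 := h2 _ h3
      rwa [show 2 * ((i + 1).toNat : ℤ) - 1 = 2 * i + 1 by omega] at h4
    · right
      exact Finset.mem_image.2 ⟨m, Finset.mem_range.2 (by omega), hm.symm⟩
  refine laurent_injective z ?_
  ext j
  rw [coeff_laurent_reflect]
  rcases Int.even_or_odd j with h | h
  · rw [h.neg_one_zpow, one_mul]
  · have h1 : (laurent z u).coeff j = 0 := LinearMap.congr_fun (hodd j h) ⟨u, hu⟩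
    rw [h1, mul_zero]

end

end FiniteGap

theorem proposition1 {N : ℕ} (f : Fin (N + 1) → FiniteGap.Mer)
    (hV : FiniteGap.IsFiniteGapSubspace (Submodule.span ℂ (Set.range f))) :
    ∀ z₀ ∈ FiniteGap.singularSet f,
      (fun z : ℂ => 2 * z₀ - z) '' FiniteGap.singularSet f = FiniteGap.singularSet f ∧
        ∀ u ∈ Submodule.span ℂ (Set.range f), FiniteGap.reflect z₀ u = u := by
  rintro z₀ ⟨i, hi⟩
  have hmem : ∀ j, f j ∈ Submodule.span ℂ (Set.range f) := fun j =>
    Submodule.subset_span ⟨j, rfl⟩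
  have hall : ∀ u ∈ Submodule.span ℂ (Set.range f), FiniteGap.reflect z₀ u = u :=
    fun u hu => hV.reflect_eq (hmem i) hi hu
  have hsub : ∀ z ∈ FiniteGap.singularSet f, 2 * z₀ - z ∈ FiniteGap.singularSet f := by
    rintro z ⟨j, hj⟩
    exact ⟨j, FiniteGap.hasPoleAt_of_hasPoleAt_reflect (by rwa [hall _ (hmem j)])⟩
  refine ⟨Set.Subset.antisymm ?_ fun z hz => ⟨2 * z₀ - z, hsub z hz, by ring⟩, hall⟩
  rintro _ ⟨z, hz, rfl⟩
  exact hsub z hz
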